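/- Let $f:[0,1]\to[0,1]$ be the Farey map, $f(x)=\frac{x}{1-x}$ for $x\in[0,\frac12]$ and $f(x)=\frac{1-x}{x}$ for $x\in[\frac12,1]$. For $\beta\in\mathbb R$ put $\phi_\beta(x)=-\beta\log|f'(x)|$ (with the one-sided derivative at the end points of $[0,1]$), and let $$\zeta(z,\beta)=\exp\sum_{n=1}^{\infty}\frac{z^n}{n}\sum_{f^n(x)=x}\exp\sum_{k=0}^{n-1}\phi_\beta(f^kx)$$ be the Ruelle zeta function, viewed as a power series in $z$ with radius of convergence $\rho(\beta)$. The pressure function of the Farey map is $P(\beta)=-\log\rho(\beta)$. It is well defined and is the exponential growth rate of the partition function: $0<\rho(\beta)<\infty$ and $$P(\beta)=\lim_{n\to\infty}\frac1n\log\sum_{i=1}^{2^n}\ell_{n,i}^{\beta}\qquad\text{for every }\beta\in\mathbb R,$$ where $\ell_{n,1},\dots,\ell_{n,2^n}$ are the lengths of the $2^n$ intervals $F_{e_1}\circ\cdots\circ F_{e_n}([0,1])$, $e_1,\dots,e_n\in\{0,1\}$, with $F_1(x)=\frac{x}{1+x}$ and $F_0(x)=\frac1{1+x}$ the inverse branches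 of $f$. Moreover $P(0)=\log 2$ and $P(\beta)=0$ for all $\beta\ge 1$; the function $P$ is not real-analytic on $\mathbb R$; and $P$ exhibits a phase transition somewhere in $(0,1]$, that is, there is a $\beta\in(0,1]$ at which $P$ is not real-analytic. -/

import Mathlib

open Set Filter Topology

noncomputable section

/-- The Farey map: `x / (1 - x)` on `[0, 1/2]` and `(1 - x) / x` on `[1/2, 1]`.
It is only ever used on the unit interval, which it maps to itself. -/
def fareyMap (x : ℝ) : ℝ :=
  if x ≤ 1 / 2 then x / (1 - x) else (1 - x) / x

/-- The interaction `φ(x) = -β log |f'(x)|` (one-sided derivatives at the end points of `[0, 1]`). -/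
def fareyInteraction (β x : ℝ) : ℝ :=
  -β * Real.log |derivWithin fareyMap (Icc 0 1) x|

/-- The solutions in `[0, 1]` of `f^n x = x`. -/
def fareyPeriodicPoints (n : ℕ) : Set ℝ :=
  {x | x ∈ Icc (0 : ℝ) 1 ∧ fareyMap^[n] x = x}

/-- The sum over all `x` with `f^n x = x` of `exp (∑ k < n, φ (f^k x))`
(for `n ≥ 1` this is a sum over a finite set). -/
def fareyPeriodicSum (β : ℝ) (n : ℕ) : ℝ :=
  ∑ᶠ x ∈ fareyPeriodicPoints n,
    Real.exp (∑ k ∈ Finset.range n, fareyInteraction β (fareyMap^[k] x))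

/-- The power series `∑ n ≥ 1, (z ^ n / n) * fareyPeriodicSum β n`. -/
def fareyLogZeta (β : ℝ) : PowerSeries ℝ :=
  PowerSeries.mk fun n => if n = 0 then 0 else fareyPeriodicSum β n / n

/-- The composition of `exp` with `fareyLogZeta β` is a legitimate power series. -/
theorem fareyLogZeta_hasSubst (β : ℝ) : PowerSeries.HasSubst (fareyLogZeta β) :=
  PowerSeries.HasSubst.of_constantCoeff_zero' (by simp [fareyLogZeta])

/-- The Ruelle zeta function `ζ(z, β) = exp (∑ n ≥ 1, (z ^ n / n) * fareyPeriodicSum β n)`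
of the Farey system, as a power series in `z`. -/
def fareyZeta (β : ℝ) : PowerSeries ℝ :=
  (PowerSeries.exp ℝ).subst (fareyLogZeta β)

/-- The radius of convergence of `ζ(z, β)` as a power series in the complex variable `z`. -/
def fareyZetaRadius (β : ℝ) : ENNReal :=
  (FormalMultilinearSeries.ofScalars ℂ fun n => PowerSeries.coeff n (fareyZeta β)).radius

/-- The pressure function of the Farey map: minus the logarithm of the radius of convergence of
the zeta function. -/
def fareyPressure (β : ℝ) : ℝ :=
  -Real.log (fareyZetaRadius β).toReal

/-- The inverse branches of the Farey map: `true` stands for the symbol `1` (left branch) and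
`false` for the symbol `0` (right branch). -/
def fareyInverseBranch : Bool → ℝ → ℝ
  | true, x => x / (1 + x)
  | false, x => 1 / (1 + x)

/-- The composition of inverse branches along a word. The image of `[0, 1]` is the closed interval
of the points whose itinerary under the Farey map starts with this word. -/
def fareyInverseWord : List Bool → ℝ → ℝ
  | [], x => x
  | b :: w, x => fareyInverseBranch b (fareyInverseWord w x)

/-- The partition function `∑ ℓ_i ^ β`, where `ℓ_i` runs through the lengths of the `2 ^ n`
intervals of the partition of `[0, 1]` given by the symbolic dynamics of `n` iterates. -/
def fareyPartitionFunction (β : ℝ) (n : ℕ) : ℝ :=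
  ∑ e : Fin n → Bool,
    |fareyInverseWord (List.ofFn e) 1 - fareyInverseWord (List.ofFn e) 0| ^ β

end

/-! Each composition `F_w` of inverse branches is a Möbius map with `|F_w'| = D_w ^ (-2)`, where
`D_w(x) = c x + d` is positive and increasing on the unit interval. By `exists_fareyDenominator_eq`,
`c ≤ n d` for a word of length `n`. So, although the fixed point 0 is neutral, the distortion of
`F_w` is at most polynomial in `n`, hence invisible at exponential scale.

The chain rule makes the sum over words of `sup |F_w'| ^ β` submultiplicative, and Fekete's lemma
gives it an exponential growth rate `p`. The partition function takes an intermediate value of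
`|F_w'| ^ β` on each interval. So does the periodic point sum `Z_n`, because each word fixes exactly
one point. Both therefore grow at rate `p`.

For the zeta function, `n c_n = ∑ c_i Z_(n-i)` (over `i < n`) shows that the coefficients `c_n` are
nonnegative. It gives `n c_n ≥ Z_n`, and it bounds `c_n r ^ n` as soon as `∑ Z_n r ^ n` converges.
Hence `ρ = exp (-p)` and `P = p`.

Finally, at `β = 1` the lengths sum to 1, while for every `β` the interval at the neutral fixed
point alone contributes `(n + 1) ^ (-β)`; so `P = 0` on `[1, ∞)`. Since `P(1/4) > 0`, the identity
theorem excludes analyticity on all of `(0, 1]`. -/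

noncomputable section

/-! ### Inverse branches as Möbius maps: lengths and distortion -/

/-- The denominator of the Möbius transformation `fareyInverseWord w`, up to sign the inverse square
root of its derivative. -/
def fareyDenominator : List Bool → ℝ → ℝ
  | [], _ => 1
  | _ :: w, x => (1 + fareyInverseWord w x) * fareyDenominator w x

theorem fareyInverseBranch_mem (b : Bool) {x : ℝ} (hx : x ∈ Icc (0 : ℝ) 1) :
    fareyInverseBranch b x ∈ Icc (0 : ℝ) 1 := by
  obtain ⟨h0, h1⟩ := hx
  have : 0 < 1 + x := by linarith
  cases b <;> simp only [fareyInverseBranch, mem_Icc] <;>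
    exact ⟨by positivity, by rw [div_le_one this]; linarith⟩

theorem fareyInverseBranch_pos (b : Bool) {x : ℝ} (hx : 0 < x) : 0 < fareyInverseBranch b x := by
  cases b <;> simp only [fareyInverseBranch] <;> positivity

theorem fareyInverseBranch_sub (b : Bool) {x y : ℝ} (hx : 0 ≤ x) (hy : 0 ≤ y) :
    |fareyInverseBranch b x - fareyInverseBranch b y| = |x - y| / ((1 + x) * (1 + y)) := by
  have h1 : 0 < 1 + x := by linarith
  have h2 : 0 < 1 + y := by linarith
  cases b <;> simp only [fareyInverseBranch]
  · rw [div_sub_div _ _ h1.ne' h2.ne', abs_div, abs_of_pos (mul_pos h1 h2), abs_sub_comm x y]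
    ring_nf
  · rw [div_sub_div _ _ h1.ne' h2.ne', abs_div, abs_of_pos (mul_pos h1 h2)]
    ring_nf

theorem fareyInverseWord_mem (w : List Bool) {x : ℝ} (hx : x ∈ Icc (0 : ℝ) 1) :
    fareyInverseWord w x ∈ Icc (0 : ℝ) 1 := by
  induction w with
  | nil => exact hx
  | cons b w ih => exact fareyInverseBranch_mem b ih

theorem fareyInverseWord_pos (w : List Bool) {x : ℝ} (hx : 0 < x) : 0 < fareyInverseWord w x := by
  induction w with
  | nil => exact hx
  | cons b w ih => exact fareyInverseBranch_pos b ih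

theorem fareyInverseWord_append (v w : List Bool) (x : ℝ) :
    fareyInverseWord (v ++ w) x = fareyInverseWord v (fareyInverseWord w x) := by
  induction v with
  | nil => rfl
  | cons b v ih => simp [fareyInverseWord, ih]

theorem fareyDenominator_append (v w : List Bool) (x : ℝ) :
    fareyDenominator (v ++ w) x =
      fareyDenominator v (fareyInverseWord w x) * fareyDenominator w x := by
  induction v with
  | nil => simp [fareyDenominator]
  | cons b v ih => simp [fareyDenominator, ih, fareyInverseWord_append, mul_assoc]

theorem one_le_fareyDenominator (w : List Bool) {x : ℝ} (hx : x ∈ Icc (0 : ℝ) 1) :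
    1 ≤ fareyDenominator w x := by
  induction w with
  | nil => exact le_rfl
  | cons b w ih =>
    exact one_le_mul_of_one_le_of_one_le (by linarith [(fareyInverseWord_mem w hx).1]) ih

theorem fareyDenominator_pos (w : List Bool) {x : ℝ} (hx : x ∈ Icc (0 : ℝ) 1) :
    0 < fareyDenominator w x :=
  zero_lt_one.trans_le (one_le_fareyDenominator w hx)

theorem one_lt_fareyDenominator {w : List Bool} (hw : w ≠ []) {x : ℝ} (h0 : 0 < x) (h1 : x ≤ 1) :
    1 < fareyDenominator w x := by
  cases w with
  | nil => exact absurd rfl hw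
  | cons b w =>
    exact one_lt_mul_of_lt_of_le (by linarith [fareyInverseWord_pos w h0])
      (one_le_fareyDenominator w ⟨h0.le, h1⟩)

theorem fareyDenominator_le_two_pow (w : List Bool) {x : ℝ} (hx : x ∈ Icc (0 : ℝ) 1) :
    fareyDenominator w x ≤ 2 ^ w.length := by
  induction w with
  | nil => simp [fareyDenominator]
  | cons b w ih =>
    have h := fareyInverseWord_mem w hx
    rw [fareyDenominator, List.length_cons, pow_succ']
    exact mul_le_mul (by linarith [h.2]) ih (fareyDenominator_pos w hx).le zero_le_two

theorem fareyInverseWord_sub (w : List Bool) {x y : ℝ} (hx : x ∈ Icc (0 : ℝ) 1)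
    (hy : y ∈ Icc (0 : ℝ) 1) :
    |fareyInverseWord w x - fareyInverseWord w y| =
      |x - y| / (fareyDenominator w x * fareyDenominator w y) := by
  induction w with
  | nil => simp [fareyInverseWord, fareyDenominator]
  | cons b w ih =>
    simp only [fareyInverseWord, fareyDenominator]
    rw [fareyInverseBranch_sub b (fareyInverseWord_mem w hx).1 (fareyInverseWord_mem w hy).1, ih,
      div_div]
    congr 1
    ring

/-- Numerator and denominator of `fareyInverseWord w` are affine, with slopes at most linear in the
length of `w` when compared with the constant terms. -/
theorem exists_fareyDenominator_eq (w : List Bool) :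
    ∃ a b c d : ℝ, 0 ≤ a ∧ 0 ≤ b ∧ 0 ≤ c ∧ 1 ≤ d ∧ a ≤ w.length * b + 1 ∧ c ≤ w.length * d ∧
      ∀ x ∈ Icc (0 : ℝ) 1, fareyInverseWord w x * fareyDenominator w x = a * x + b ∧
        fareyDenominator w x = c * x + d := by
  induction w with
  | nil => exact ⟨1, 0, 0, 1, by simp [fareyInverseWord, fareyDenominator]⟩
  | cons s w ih =>
    obtain ⟨a, b, c, d, ha, hb, hc, hd, hab, hcd, h⟩ := ih
    have hpos (x : ℝ) (hx : x ∈ Icc (0 : ℝ) 1) : 1 + fareyInverseWord w x ≠ 0 := by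
      linarith [(fareyInverseWord_mem w hx).1]
    cases s
    -- With `F_w = N / D`, the right branch gives `D / (N + D)` and the left branch `N / (N + D)`.
    -- The `+ 1` in the bound for `a` is forced by the empty word (`a = 1`, `b = 0`); it is absorbed
    -- in the next denominator because `d ≥ 1`.
    · refine ⟨c, d, a + c, b + d, hc, by linarith, by linarith, by linarith, ?_, ?_, ?_⟩
      · push_cast [List.length_cons]; nlinarith
      · push_cast [List.length_cons]; nlinarith
      · intro x hx
        obtain ⟨h1, h2⟩ := h x hx
        simp only [fareyInverseWord, fareyDenominator, fareyInverseBranch]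
        constructor
        · rw [← h2, ← mul_assoc, one_div, inv_mul_cancel₀ (hpos x hx), one_mul]
        · linear_combination h1 + h2
    · refine ⟨a, b, a + c, b + d, ha, hb, by linarith, by linarith, ?_, ?_, ?_⟩
      · push_cast [List.length_cons]; nlinarith
      · push_cast [List.length_cons]; nlinarith
      · intro x hx
        obtain ⟨h1, h2⟩ := h x hx
        simp only [fareyInverseWord, fareyDenominator, fareyInverseBranch]
        constructor
        · rw [← h1, ← mul_assoc, div_mul_cancel₀ _ (hpos x hx)]
        · linear_combination h1 + h2

theorem fareyDenominator_mono (w : List Bool) {x y : ℝ} (hx : 0 ≤ x) (hxy : x ≤ y) (hy : y ≤ 1) :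
    fareyDenominator w x ≤ fareyDenominator w y := by
  obtain ⟨a, b, c, d, -, -, hc, -, -, -, h⟩ := exists_fareyDenominator_eq w
  rw [(h x ⟨hx, hxy.trans hy⟩).2, (h y ⟨hx.trans hxy, hy⟩).2]
  gcongr

theorem fareyDenominator_one_le (w : List Bool) :
    fareyDenominator w 1 ≤ (w.length + 1) * fareyDenominator w 0 := by
  obtain ⟨a, b, c, d, -, -, -, -, -, hcd, h⟩ := exists_fareyDenominator_eq w
  rw [(h 0 (by simp)).2, (h 1 (by simp)).2]
  linarith

theorem fareyInverseWord_length (w : List Bool) :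
    |fareyInverseWord w 1 - fareyInverseWord w 0| =
      1 / (fareyDenominator w 1 * fareyDenominator w 0) := by
  rw [fareyInverseWord_sub w (by simp) (by simp)]
  simp

theorem fareyInverseWord_length_pos (w : List Bool) :
    0 < |fareyInverseWord w 1 - fareyInverseWord w 0| := by
  have h1 := fareyDenominator_pos w (x := 1) (by simp)
  have h0 := fareyDenominator_pos w (x := 0) (by simp)
  rw [fareyInverseWord_length]
  positivity

/-- The two halves of an interval of the partition have the total length of the interval. -/
theorem fareyInverseWord_length_append (w : List Bool) :
    |fareyInverseWord (w ++ [true]) 1 - fareyInverseWord (w ++ [true]) 0| +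
      |fareyInverseWord (w ++ [false]) 1 - fareyInverseWord (w ++ [false]) 0| =
      |fareyInverseWord w 1 - fareyInverseWord w 0| := by
  obtain ⟨a, b, c, d, -, -, hc, hd, -, -, h⟩ := exists_fareyDenominator_eq w
  simp only [fareyInverseWord_append, fareyInverseWord, fareyInverseBranch]
  norm_num
  rw [fareyInverseWord_sub w (x := 1 / 2) (by norm_num) (by simp),
    fareyInverseWord_sub w (x := 1 / 2) (by norm_num) (by simp),
    fareyInverseWord_sub w (x := 1) (by simp) (by simp), (h 0 (by simp)).2, (h 1 (by simp)).2,
    (h (1 / 2) (by norm_num)).2]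
  have h1 : 0 < c * (1 / 2) + d := by linarith
  have h2 : 0 < c + d := by linarith
  norm_num [abs_of_pos, abs_of_neg]
  have h3 : c + d * 2 ≠ 0 := by linarith
  field_simp
  ring

/-! ### Submultiplicative weights and their growth rate -/

/-- The supremum over the unit interval of `|F'| ^ β`, where `F = fareyInverseWord w`. -/
def fareyWeight (β : ℝ) (w : List Bool) : ℝ :=
  max (fareyDenominator w 0 ^ (-2 * β)) (fareyDenominator w 1 ^ (-2 * β))

theorem fareyWeight_pos (β : ℝ) (w : List Bool) : 0 < fareyWeight β w :=
  lt_max_of_lt_left (Real.rpow_pos_of_pos (fareyDenominator_pos w (by simp)) _)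

theorem rpow_le_fareyWeight (β : ℝ) (w : List Bool) {t : ℝ} (h0 : fareyDenominator w 0 ≤ t)
    (h1 : t ≤ fareyDenominator w 1) : t ^ (-2 * β) ≤ fareyWeight β w := by
  have hpos := fareyDenominator_pos w (x := 0) (by simp)
  rcases le_total 0 β with hβ | hβ
  · exact le_max_of_le_left (Real.rpow_le_rpow_of_nonpos hpos h0 (by linarith))
  · exact le_max_of_le_right (Real.rpow_le_rpow (hpos.le.trans h0) h1 (by linarith))

theorem rpow_le_rpow_abs_mul {s t M γ : ℝ} (hs : 0 < s) (ht : 0 < t) (hst : s ≤ M * t)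
    (hts : t ≤ M * s) : s ^ γ ≤ M ^ |γ| * t ^ γ := by
  have hM : 0 < M := pos_of_mul_pos_left (hs.trans_le hst) ht.le
  rcases le_total 0 γ with hγ | hγ
  · rw [abs_of_nonneg hγ, ← Real.mul_rpow hM.le ht.le]
    exact Real.rpow_le_rpow hs.le hst hγ
  · rw [abs_of_nonpos hγ, Real.rpow_neg hM.le, ← div_eq_inv_mul, ← Real.div_rpow ht.le hM.le]
    exact Real.rpow_le_rpow_of_nonpos (by positivity) ((div_le_iff₀' hM).2 hts) hγ

theorem fareyWeight_le (β : ℝ) (w : List Bool) {t : ℝ} (h0 : fareyDenominator w 0 ≤ t)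
    (h1 : t ≤ fareyDenominator w 1) :
    fareyWeight β w ≤ (w.length + 1 : ℝ) ^ |2 * β| * t ^ (-2 * β) := by
  have hpos := fareyDenominator_pos w (x := 0) (by simp)
  have ht := hpos.trans_le h0
  have hle := fareyDenominator_one_le w
  have hn : (1 : ℝ) ≤ w.length + 1 := by simp
  have habs : |2 * β| = |-2 * β| := by rw [neg_mul, abs_neg]
  rw [habs]
  refine max_le (rpow_le_rpow_abs_mul hpos ht ?_ (h1.trans hle))
    (rpow_le_rpow_abs_mul (ht.trans_le h1) ht (hle.trans (by gcongr)) ?_)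
  · nlinarith
  · nlinarith

/-- This is the chain rule `D_(vw)(x) = D_v(F_w x) D_w(x)`, with each factor bounded by its
supremum. -/
theorem fareyWeight_append_le (β : ℝ) (v w : List Bool) :
    fareyWeight β (v ++ w) ≤ fareyWeight β v * fareyWeight β w := by
  have key (x : ℝ) (hx : x ∈ Icc (0 : ℝ) 1) :
      fareyDenominator (v ++ w) x ^ (-2 * β) ≤ fareyWeight β v * fareyWeight β w := by
    have hm := fareyInverseWord_mem w hx
    rw [fareyDenominator_append,
      Real.mul_rpow (fareyDenominator_pos v hm).le (fareyDenominator_pos w hx).le]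
    exact mul_le_mul
      (rpow_le_fareyWeight β v (fareyDenominator_mono v le_rfl hm.1 hm.2)
        (fareyDenominator_mono v hm.1 hm.2 le_rfl))
      (rpow_le_fareyWeight β w (fareyDenominator_mono w le_rfl hx.1 hx.2)
        (fareyDenominator_mono w hx.1 hx.2 le_rfl))
      (Real.rpow_pos_of_pos (fareyDenominator_pos w hx) _).le (fareyWeight_pos β v).le
  exact max_le (key 0 (by simp)) (key 1 (by simp))

/-- A crude bound, needed only to keep the limit in Fekete's lemma finite. -/
theorem two_pow_rpow_le_fareyWeight (β : ℝ) (w : List Bool) :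
    ((2 : ℝ) ^ w.length) ^ (-|2 * β|) ≤ fareyWeight β w := by
  have h1 := one_le_fareyDenominator w (x := 0) (by simp)
  refine le_trans ?_ (le_max_left _ _)
  calc ((2 : ℝ) ^ w.length) ^ (-|2 * β|) ≤ fareyDenominator w 0 ^ (-|2 * β|) :=
        Real.rpow_le_rpow_of_nonpos (by linarith) (fareyDenominator_le_two_pow w (by simp))
          (by simp)
    _ ≤ _ := Real.rpow_le_rpow_of_exponent_le h1 (by linarith [le_abs_self (2 * β)])

/-- The sum of the weights of all words of length `n`. -/
def fareyWeightSum (β : ℝ) (n : ℕ) : ℝ :=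
  ∑ e : Fin n → Bool, fareyWeight β (List.ofFn e)

theorem fareyWeightSum_pos (β : ℝ) (n : ℕ) : 0 < fareyWeightSum β n :=
  Finset.sum_pos (fun _ _ => fareyWeight_pos _ _) Finset.univ_nonempty

theorem fareyWeightSum_add_le (β : ℝ) (m n : ℕ) :
    fareyWeightSum β (m + n) ≤ fareyWeightSum β m * fareyWeightSum β n := by
  simp only [fareyWeightSum]
  rw [Finset.sum_mul_sum, ← Finset.sum_product', Finset.univ_product_univ,
    ← (Fin.appendEquiv m n).sum_comp]
  refine Finset.sum_le_sum fun p _ => ?_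
  simp only [Fin.appendEquiv, Equiv.coe_fn_mk, List.ofFn_fin_append]
  exact fareyWeight_append_le β _ _

theorem two_pow_rpow_le_fareyWeightSum (β : ℝ) (n : ℕ) :
    ((2 : ℝ) ^ n) ^ (-|2 * β|) ≤ fareyWeightSum β n := by
  have h := two_pow_rpow_le_fareyWeight β (List.ofFn fun _ : Fin n => true)
  rw [List.length_ofFn] at h
  exact h.trans (Finset.single_le_sum (f := fun e : Fin n → Bool => fareyWeight β (List.ofFn e))
    (fun _ _ => (fareyWeight_pos _ _).le) (Finset.mem_univ fun _ => true))

theorem subadditive_log_fareyWeightSum (β : ℝ) :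
    Subadditive fun n => Real.log (fareyWeightSum β n) := by
  intro m n
  rw [← Real.log_mul (fareyWeightSum_pos β m).ne' (fareyWeightSum_pos β n).ne']
  exact Real.log_le_log (fareyWeightSum_pos β _) (fareyWeightSum_add_le β m n)

theorem exists_tendsto_log_fareyWeightSum (β : ℝ) :
    ∃ p, Tendsto (fun n : ℕ => Real.log (fareyWeightSum β n) / n) atTop (𝓝 p) := by
  refine ⟨_, (subadditive_log_fareyWeightSum β).tendsto_lim
    -- The `0` in the minimum covers `n = 0`, where the quotient is `0` by convention.
    ⟨min 0 (-|2 * β| * Real.log 2), ?_⟩⟩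
  rintro _ ⟨n, rfl⟩
  rcases n.eq_zero_or_pos with rfl | hn
  · simp
  · refine min_le_of_right_le ?_
    have hn' : (0 : ℝ) < n := by exact_mod_cast hn
    have h := Real.log_le_log (by positivity) (two_pow_rpow_le_fareyWeightSum β n)
    rw [Real.log_rpow (by positivity), Real.log_pow] at h
    simp only
    rw [le_div_iff₀ hn']
    linarith

theorem tendsto_log_add_one_div :
    Tendsto (fun n : ℕ => Real.log (n + 1 : ℝ) / n) atTop (𝓝 0) := by
  have h : Tendsto (fun x : ℝ => Real.log x ^ 1 / (1 * x + (-1))) atTop (𝓝 0) :=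
    Real.tendsto_pow_log_div_mul_add_atTop 1 (-1) 1 one_ne_zero
  refine (h.comp (tendsto_atTop_add_const_right atTop (1 : ℝ)
    tendsto_natCast_atTop_atTop)).congr fun n => ?_
  simp

/-- A polynomial factor does not change an exponential growth rate. The index 0 is excluded because
`fareyPeriodicSum β 0` is a `finsum` with infinite support, hence `0`. -/
theorem tendsto_log_of_fareyWeightSum_le {β p : ℝ} {X : ℕ → ℝ} (hX : ∀ n ≠ 0, 0 < X n)
    (h1 : ∀ n ≠ 0, X n ≤ fareyWeightSum β n)
    (h2 : ∀ n ≠ 0, fareyWeightSum β n ≤ (n + 1 : ℝ) ^ |2 * β| * X n)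
    (hp : Tendsto (fun n : ℕ => Real.log (fareyWeightSum β n) / n) atTop (𝓝 p)) :
    Tendsto (fun n : ℕ => Real.log (X n) / n) atTop (𝓝 p) := by
  have hlow := hp.sub (tendsto_log_add_one_div.const_mul |2 * β|)
  rw [mul_zero, sub_zero] at hlow
  refine tendsto_of_tendsto_of_tendsto_of_le_of_le' hlow hp ?_ ?_
  · filter_upwards [eventually_gt_atTop 0] with n hn
    have hn' : (0 : ℝ) < n := by exact_mod_cast hn
    have h := Real.log_le_log (fareyWeightSum_pos β n) (h2 n hn.ne')
    rw [Real.log_mul (by positivity) (hX n hn.ne').ne', Real.log_rpow (by positivity)] at h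
    rw [← mul_div_assoc, ← sub_div]
    gcongr
    linarith
  · filter_upwards [eventually_gt_atTop 0] with n hn
    exact div_le_div_of_nonneg_right (Real.log_le_log (hX n hn.ne') (h1 n hn.ne')) n.cast_nonneg

/-! ### The partition function -/

theorem fareyInverseWord_length_rpow (β : ℝ) (w : List Bool) :
    |fareyInverseWord w 1 - fareyInverseWord w 0| ^ β =
      √(fareyDenominator w 1 * fareyDenominator w 0) ^ (-2 * β) := by
  have h1 := fareyDenominator_pos w (x := 1) (by simp)
  have h0 := fareyDenominator_pos w (x := 0) (by simp)
  rw [fareyInverseWord_length, Real.rpow_mul (Real.sqrt_nonneg _), Real.rpow_neg (by positivity)]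
  norm_cast
  rw [Real.sq_sqrt (by positivity), one_div]

theorem sqrt_fareyDenominator_mem (w : List Bool) :
    √(fareyDenominator w 1 * fareyDenominator w 0) ∈
      Icc (fareyDenominator w 0) (fareyDenominator w 1) := by
  have h0 := fareyDenominator_pos w (x := 0) (by simp)
  have h := fareyDenominator_mono w le_rfl zero_le_one le_rfl
  exact ⟨Real.le_sqrt_of_sq_le (by nlinarith), Real.sqrt_le_iff.2 ⟨by linarith, by nlinarith⟩⟩

theorem fareyPartitionFunction_pos (β : ℝ) (n : ℕ) : 0 < fareyPartitionFunction β n :=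
  Finset.sum_pos (fun _ _ => Real.rpow_pos_of_pos (fareyInverseWord_length_pos _) _)
    Finset.univ_nonempty

theorem tendsto_log_fareyPartitionFunction {β p : ℝ}
    (hp : Tendsto (fun n : ℕ => Real.log (fareyWeightSum β n) / n) atTop (𝓝 p)) :
    Tendsto (fun n : ℕ => Real.log (fareyPartitionFunction β n) / n) atTop (𝓝 p) := by
  refine tendsto_log_of_fareyWeightSum_le (fun n _ => fareyPartitionFunction_pos β n)
    (fun n _ => Finset.sum_le_sum fun e _ => ?_) (fun n _ => ?_) hp
  · rw [fareyInverseWord_length_rpow]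
    exact rpow_le_fareyWeight β _ (sqrt_fareyDenominator_mem _).1 (sqrt_fareyDenominator_mem _).2
  · rw [fareyPartitionFunction, Finset.mul_sum]
    refine Finset.sum_le_sum fun e _ => ?_
    rw [fareyInverseWord_length_rpow]
    simpa using fareyWeight_le β (List.ofFn e) (sqrt_fareyDenominator_mem _).1
      (sqrt_fareyDenominator_mem _).2

theorem fareyPartitionFunction_zero (n : ℕ) : fareyPartitionFunction 0 n = 2 ^ n := by
  simp [fareyPartitionFunction]

theorem fareyPartitionFunction_one (n : ℕ) : fareyPartitionFunction 1 n = 1 := by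
  simp only [fareyPartitionFunction, Real.rpow_one]
  induction n with
  | zero => simp [fareyInverseWord]
  | succ n ih =>
    -- The appended last letter acts innermost, so it splits the interval of `e` in two and
    -- preserves total length.
    have h (e : Fin n → Bool) (b : Bool) :
        List.ofFn (Fin.snocEquiv (fun _ => Bool) (b, e)) = List.ofFn e ++ [b] := by
      rw [List.ofFn_succ', List.concat_eq_append]
      simp [Fin.snocEquiv]
    rw [← (Fin.snocEquiv fun _ => Bool).sum_comp, Fintype.sum_prod_type, Fintype.sum_bool,
      ← Finset.sum_add_distrib]
    refine Eq.trans (Finset.sum_congr rfl fun e _ => ?_) ih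
    rw [h, h]
    exact fareyInverseWord_length_append _

theorem fareyPartitionFunction_le_one {β : ℝ} (hβ : 1 ≤ β) (n : ℕ) :
    fareyPartitionFunction β n ≤ 1 := by
  rw [← fareyPartitionFunction_one n]
  refine Finset.sum_le_sum fun e _ => Real.rpow_le_rpow_of_exponent_ge
    (fareyInverseWord_length_pos _) ?_ hβ
  have h1 := one_le_fareyDenominator (List.ofFn e) (x := 1) (by simp)
  have h0 := one_le_fareyDenominator (List.ofFn e) (x := 0) (by simp)
  rw [fareyInverseWord_length, div_le_one (by positivity)]
  exact one_le_mul_of_one_le_of_one_le h1 h0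

theorem fareyInverseWord_replicate_true (n : ℕ) {x : ℝ} (hx : 0 ≤ x) :
    fareyInverseWord (List.replicate n true) x = x / (n * x + 1) := by
  induction n with
  | zero => simp [fareyInverseWord]
  | succ n ih =>
    rw [List.replicate_succ, fareyInverseWord, ih, fareyInverseBranch]
    have h : 0 < n * x + 1 := by positivity
    have h' : 0 < n * x + 1 + x := by positivity
    push_cast
    field_simp
    congr 1
    ring

theorem rpow_le_fareyPartitionFunction (β : ℝ) (n : ℕ) :
    (n + 1 : ℝ) ^ (-β) ≤ fareyPartitionFunction β n := by
  refine le_trans (le_of_eq ?_) (Finset.single_le_sum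
    (f := fun e : Fin n → Bool =>
      |fareyInverseWord (List.ofFn e) 1 - fareyInverseWord (List.ofFn e) 0| ^ β)
    (fun _ _ => by positivity) (Finset.mem_univ fun _ => true))
  simp only [List.ofFn_const]
  rw [fareyInverseWord_replicate_true n le_rfl, fareyInverseWord_replicate_true n zero_le_one,
    Real.rpow_neg (by positivity), ← Real.inv_rpow (by positivity), mul_one, mul_zero, zero_div,
    sub_zero, one_div, abs_of_nonneg (by positivity)]

/-- Every length is at least `4 ^ (-n)`. This yields positive pressure for small `β`. -/
theorem two_pow_mul_rpow_le_fareyPartitionFunction {β : ℝ} (hβ : 0 ≤ β) (n : ℕ) :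
    2 ^ n * ((4 : ℝ) ^ n) ^ (-β) ≤ fareyPartitionFunction β n := by
  have h : 2 ^ n * ((4 : ℝ) ^ n) ^ (-β) = ∑ _e : Fin n → Bool, ((4 : ℝ) ^ n) ^ (-β) := by simp
  rw [h]
  refine Finset.sum_le_sum fun e _ => ?_
  have h1 := fareyDenominator_le_two_pow (List.ofFn e) (x := 1) (by simp)
  have h0 := fareyDenominator_le_two_pow (List.ofFn e) (x := 0) (by simp)
  have h1' := fareyDenominator_pos (List.ofFn e) (x := 1) (by simp)
  have h0' := fareyDenominator_pos (List.ofFn e) (x := 0) (by simp)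
  rw [List.length_ofFn] at h0 h1
  rw [fareyInverseWord_length, Real.rpow_neg (by positivity), ← Real.inv_rpow (by positivity),
    ← one_div]
  refine Real.rpow_le_rpow (by positivity) ?_ hβ
  refine one_div_le_one_div_of_le (by positivity) ((mul_le_mul h1 h0 h0'.le (by positivity)).trans ?_)
  rw [← mul_pow]
  norm_num

/-! ### Itineraries and periodic points of the Farey map -/

theorem fareyMap_mem {x : ℝ} (hx : x ∈ Icc (0 : ℝ) 1) : fareyMap x ∈ Icc (0 : ℝ) 1 := by
  obtain ⟨h0, h1⟩ := hx
  unfold fareyMap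
  split_ifs with h
  · have : 0 < 1 - x := by linarith
    exact ⟨by positivity, by rw [div_le_one this]; linarith⟩
  · have : 0 < x := by linarith
    exact ⟨div_nonneg (by linarith) h0, by rw [div_le_one this]; linarith⟩

theorem fareyMap_iterate_mem (n : ℕ) {x : ℝ} (hx : x ∈ Icc (0 : ℝ) 1) :
    fareyMap^[n] x ∈ Icc (0 : ℝ) 1 :=
  MapsTo.iterate (fun _ => fareyMap_mem) n hx

theorem fareyMap_fareyInverseBranch (b : Bool) {u : ℝ} (hu : u ∈ Icc (0 : ℝ) 1) :
    fareyMap (fareyInverseBranch b u) = u := by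
  obtain ⟨h0, h1⟩ := hu
  have h : 0 < 1 + u := by linarith
  cases b
  · change fareyMap (1 / (1 + u)) = u
    unfold fareyMap
    split_ifs with hle
    · rw [div_le_div_iff₀ h two_pos] at hle
      obtain rfl : u = 1 := by linarith
      norm_num
    · field_simp
      ring
  · change fareyMap (u / (1 + u)) = u
    rw [fareyMap, if_pos (by rw [div_le_div_iff₀ h two_pos]; linarith)]
    field_simp
    ring

theorem fareyInverseBranch_fareyMap {x : ℝ} (hx : x ∈ Icc (0 : ℝ) 1) :
    fareyInverseBranch (decide (x ≤ 1 / 2)) (fareyMap x) = x := by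
  obtain ⟨h0, h1⟩ := hx
  unfold fareyMap
  by_cases h : x ≤ 1 / 2
  · have : 1 - x ≠ 0 := by linarith
    simp only [h, decide_true, fareyInverseBranch, if_true]
    field_simp
    ring
  · have : x ≠ 0 := by linarith
    simp only [h, decide_false, fareyInverseBranch, if_false]
    field_simp
    ring

theorem decide_fareyInverseBranch_le {b : Bool} {u : ℝ} (hu : u ∈ Icc (0 : ℝ) 1)
    (h : fareyInverseBranch b u ≠ 1 / 2) : decide (fareyInverseBranch b u ≤ 1 / 2) = b := by
  obtain ⟨h0, h1⟩ := hu
  have hpos : 0 < 1 + u := by linarith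
  cases b
  · change 1 / (1 + u) ≠ 1 / 2 at h
    change decide (1 / (1 + u) ≤ 1 / 2) = false
    rw [decide_eq_false_iff_not]
    refine fun hle => h (le_antisymm hle ?_)
    rw [div_le_div_iff₀ two_pos hpos]
    linarith
  · change decide (u / (1 + u) ≤ 1 / 2) = true
    rw [decide_eq_true_iff, div_le_div_iff₀ hpos two_pos]
    linarith

theorem derivWithin_fareyMap_of_lt {x : ℝ} (h0 : 0 ≤ x) (h : x < 1 / 2) :
    derivWithin fareyMap (Icc 0 1) x = 1 / (1 - x) ^ 2 := by
  have hne : 1 - x ≠ 0 := by linarith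
  have hd : HasDerivAt (fun y : ℝ => y / (1 - y)) (1 / (1 - x) ^ 2) x := by
    refine ((hasDerivAt_id x).div ((hasDerivAt_id x).const_sub 1) hne).congr_deriv ?_
    simp
  have heq : fareyMap =ᶠ[𝓝 x] fun y => y / (1 - y) := by
    filter_upwards [Iio_mem_nhds h] with y hy
    exact if_pos (le_of_lt hy)
  exact (hd.congr_of_eventuallyEq heq).hasDerivWithinAt.derivWithin
    (uniqueDiffOn_Icc_zero_one x ⟨h0, by linarith⟩)

theorem derivWithin_fareyMap_of_gt {x : ℝ} (h : 1 / 2 < x) (h1 : x ≤ 1) :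
    derivWithin fareyMap (Icc 0 1) x = -(1 / x ^ 2) := by
  have hne : x ≠ 0 := by linarith
  have hd : HasDerivAt (fun y : ℝ => (1 - y) / y) (-(1 / x ^ 2)) x := by
    refine (((hasDerivAt_id x).const_sub 1).div (hasDerivAt_id x) hne).congr_deriv ?_
    simp
    ring
  have heq : fareyMap =ᶠ[𝓝 x] fun y => (1 - y) / y := by
    filter_upwards [Ioi_mem_nhds h] with y hy
    exact if_neg (not_le.2 hy)
  exact (hd.congr_of_eventuallyEq heq).hasDerivWithinAt.derivWithin
    (uniqueDiffOn_Icc_zero_one x ⟨by linarith, h1⟩)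

/-- On both branches `|f'| = (1 + f) ^ 2`. The point `1/2` is excluded: the one-sided derivatives
there are `4` and `-4`, so `derivWithin` takes its default value `0`. -/
theorem fareyInteraction_eq (β : ℝ) {x : ℝ} (hx : x ∈ Icc (0 : ℝ) 1) (h : x ≠ 1 / 2) :
    fareyInteraction β x = -2 * β * Real.log (1 + fareyMap x) := by
  obtain ⟨h0, h1⟩ := hx
  rcases lt_or_gt_of_ne h with h | h
  · have hpos : 0 < 1 - x := by linarith
    have heq : 1 + fareyMap x = (1 - x)⁻¹ := by
      rw [fareyMap, if_pos h.le]
      field_simp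
      ring
    rw [fareyInteraction, derivWithin_fareyMap_of_lt h0 h, heq, Real.log_abs, one_div,
      Real.log_inv, Real.log_inv, Real.log_pow]
    push_cast
    ring
  · have hpos : 0 < x := by linarith
    have heq : 1 + fareyMap x = x⁻¹ := by
      rw [fareyMap, if_neg (not_le.2 h)]
      field_simp
      ring
    rw [fareyInteraction, derivWithin_fareyMap_of_gt h h1, heq, abs_neg, Real.log_abs, one_div,
      Real.log_inv, Real.log_inv, Real.log_pow]
    push_cast
    ring

/-- The itinerary of `x` under the first `n` iterates of the Farey map. -/
def fareyItinerary (n : ℕ) (x : ℝ) : List Bool :=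
  List.ofFn fun i : Fin n => decide (fareyMap^[i] x ≤ 1 / 2)

theorem fareyItinerary_succ (n : ℕ) (x : ℝ) :
    fareyItinerary (n + 1) x = decide (x ≤ 1 / 2) :: fareyItinerary n (fareyMap x) := by
  rw [fareyItinerary, List.ofFn_succ]
  rfl

theorem fareyInverseWord_fareyItinerary (n : ℕ) {x : ℝ} (hx : x ∈ Icc (0 : ℝ) 1) :
    fareyInverseWord (fareyItinerary n x) (fareyMap^[n] x) = x := by
  induction n generalizing x with
  | zero => rfl
  | succ n ih =>
    rw [fareyItinerary_succ, fareyInverseWord, Function.iterate_succ_apply, ih (fareyMap_mem hx),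
      fareyInverseBranch_fareyMap hx]

theorem fareyMap_iterate_fareyInverseWord (w : List Bool) {y : ℝ} (hy : y ∈ Icc (0 : ℝ) 1) :
    fareyMap^[w.length] (fareyInverseWord w y) = y := by
  induction w with
  | nil => rfl
  | cons b w ih =>
    rw [List.length_cons, Function.iterate_succ_apply, fareyInverseWord,
      fareyMap_fareyInverseBranch b (fareyInverseWord_mem w hy), ih]

theorem fareyItinerary_fareyInverseWord (w : List Bool) {y : ℝ} (hy : y ∈ Icc (0 : ℝ) 1)
    (h : ∀ k, fareyMap^[k] (fareyInverseWord w y) ≠ 1 / 2) :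
    fareyItinerary w.length (fareyInverseWord w y) = w := by
  induction w with
  | nil => rfl
  | cons b w ih =>
    have hw := fareyInverseWord_mem w hy
    rw [List.length_cons, fareyItinerary_succ, fareyInverseWord, fareyMap_fareyInverseBranch b hw,
      decide_fareyInverseBranch_le hw (h 0), ih]
    intro k
    have hk := h (k + 1)
    rwa [Function.iterate_succ_apply, fareyInverseWord, fareyMap_fareyInverseBranch b hw] at hk

theorem sum_fareyInteraction (β : ℝ) (n : ℕ) {x : ℝ} (hx : x ∈ Icc (0 : ℝ) 1)
    (h : ∀ k, fareyMap^[k] x ≠ 1 / 2) :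
    ∑ k ∈ Finset.range n, fareyInteraction β (fareyMap^[k] x) =
      -2 * β * Real.log (fareyDenominator (fareyItinerary n x) (fareyMap^[n] x)) := by
  induction n generalizing x with
  | zero => simp [fareyItinerary, fareyDenominator]
  | succ n ih =>
    have hf := fareyMap_mem hx
    rw [Finset.sum_range_succ']
    simp only [Function.iterate_succ_apply, Function.iterate_zero, id_eq]
    rw [ih hf fun k => h (k + 1), fareyItinerary_succ, fareyDenominator,
      fareyInverseWord_fareyItinerary n hf, fareyInteraction_eq β hx (h 0),
      Real.log_mul (by linarith [hf.1])
        (fareyDenominator_pos _ (fareyMap_iterate_mem n hf)).ne']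
    ring

/-- The orbit of `1/2` is `1/2, 1, 0, 0, …`. A periodic orbit through `1/2` would thus be that of
the fixed point 0, which misses `1/2`. Hence periodic points have unambiguous itineraries. -/
theorem fareyMap_iterate_ne_half {n : ℕ} (hn : n ≠ 0) {x : ℝ} (hx : fareyMap^[n] x = x) (k : ℕ) :
    fareyMap^[k] x ≠ 1 / 2 := by
  have h0 (j : ℕ) : fareyMap^[j] 0 = 0 := Function.iterate_fixed (by simp [fareyMap]) j
  intro hk
  -- A multiple of the period, large enough for the orbit to have reached 0.
  obtain ⟨m, hm⟩ : ∃ m, n * (k + 2) = m + 2 + k :=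
    ⟨n * (k + 2) - (2 + k), by
      have := Nat.le_mul_of_pos_left (k + 2) (Nat.pos_of_ne_zero hn)
      omega⟩
  have hx' : fareyMap^[n * (k + 2)] x = x := by
    rw [Function.iterate_mul]
    exact Function.iterate_fixed hx _
  have h2 : fareyMap^[2] (1 / 2) = 0 := by norm_num [fareyMap]
  rw [hm, Function.iterate_add_apply, Function.iterate_add_apply, hk, h2, h0] at hx'
  rw [← hx', h0] at hk
  norm_num at hk

theorem exists_fareyInverseWord_eq_self (w : List Bool) :
    ∃ x ∈ Icc (0 : ℝ) 1, fareyInverseWord w x = x := by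
  have hlip : LipschitzOnWith 1 (fareyInverseWord w) (Icc 0 1) := by
    refine LipschitzOnWith.of_dist_le_mul fun x hx y hy => ?_
    rw [Real.dist_eq, Real.dist_eq, fareyInverseWord_sub w hx hy, NNReal.coe_one, one_mul]
    exact div_le_self (abs_nonneg _) (one_le_mul_of_one_le_of_one_le
      (one_le_fareyDenominator w hx) (one_le_fareyDenominator w hy))
  exact exists_mem_Icc_isFixedPt_of_mapsTo hlip.continuousOn zero_le_one
    fun x hx => fareyInverseWord_mem w hx

/-- The contraction principle is unavailable, since the derivative may be 1 at 0. But of two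
distinct fixed points the larger is positive, so `D_w > 1` there and `F_w` would strictly shrink
their distance. -/
theorem eq_of_fareyInverseWord_eq_self {w : List Bool} (hw : w ≠ []) {x y : ℝ}
    (hx : x ∈ Icc (0 : ℝ) 1) (hy : y ∈ Icc (0 : ℝ) 1) (hxw : fareyInverseWord w x = x)
    (hyw : fareyInverseWord w y = y) : x = y := by
  wlog hlt : x < y generalizing x y
  · rcases (not_lt.1 hlt).eq_or_lt with h | h
    · exact h.symm
    · exact (this hy hx hyw hxw h).symm
  have h := fareyInverseWord_sub w hx hy
  have h1 := one_lt_mul_of_le_of_lt (one_le_fareyDenominator w hx)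
    (one_lt_fareyDenominator hw (hx.1.trans_lt hlt) hy.2)
  rw [hxw, hyw] at h
  exact absurd h.symm (div_lt_self (abs_pos.2 (sub_ne_zero.2 hlt.ne)) h1).ne

/-- Each word of length `n` contributes exactly one solution of `f^n x = x`. -/
theorem exists_fareyPeriodicSum_eq (β : ℝ) {n : ℕ} (hn : n ≠ 0) :
    ∃ x : (Fin n → Bool) → ℝ, (∀ e, x e ∈ Icc (0 : ℝ) 1) ∧
      fareyPeriodicSum β n = ∑ e, fareyDenominator (List.ofFn e) (x e) ^ (-2 * β) := by
  choose x hx hfix using fun e : Fin n → Bool => exists_fareyInverseWord_eq_self (List.ofFn e)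
  have hper (e) : fareyMap^[n] (x e) = x e := by
    have h := fareyMap_iterate_fareyInverseWord (List.ofFn e) (hx e)
    rwa [List.length_ofFn, hfix] at h
  have hhalf (e) := fareyMap_iterate_ne_half hn (hper e)
  have hitin (e) : fareyItinerary n (x e) = List.ofFn e := by
    have h := fareyItinerary_fareyInverseWord (List.ofFn e) (hx e)
    rw [List.length_ofFn, hfix] at h
    exact h (hhalf e)
  -- The word is recovered from its fixed point as the itinerary.
  have hinj : Function.Injective x := fun e e' h =>
    List.ofFn_injective (by rw [← hitin e, ← hitin e', h])
  have hrange : fareyPeriodicPoints n = range x := by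
    ext y
    constructor
    · rintro ⟨hy, hyn⟩
      refine ⟨fun i => decide (fareyMap^[i] y ≤ 1 / 2), ?_⟩
      have h := fareyInverseWord_fareyItinerary n hy
      rw [hyn] at h
      refine eq_of_fareyInverseWord_eq_self (w := fareyItinerary n y) ?_ (hx _) hy (hfix _) h
      simpa [fareyItinerary, List.ofFn_eq_nil_iff] using hn
    · rintro ⟨e, rfl⟩
      exact ⟨hx e, hper e⟩
  refine ⟨x, hx, ?_⟩
  rw [fareyPeriodicSum, hrange, finsum_mem_range hinj, finsum_eq_sum_of_fintype]
  refine Finset.sum_congr rfl fun e _ => ?_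
  rw [sum_fareyInteraction β n (hx e) (hhalf e), hitin, hper,
    Real.rpow_def_of_pos (fareyDenominator_pos _ (hx e)), mul_comm]

theorem fareyPeriodicSum_pos (β : ℝ) {n : ℕ} (hn : n ≠ 0) : 0 < fareyPeriodicSum β n := by
  obtain ⟨x, hx, h⟩ := exists_fareyPeriodicSum_eq β hn
  rw [h]
  exact Finset.sum_pos (fun e _ => Real.rpow_pos_of_pos (fareyDenominator_pos _ (hx e)) _)
    Finset.univ_nonempty

theorem tendsto_log_fareyPeriodicSum {β p : ℝ}
    (hp : Tendsto (fun n : ℕ => Real.log (fareyWeightSum β n) / n) atTop (𝓝 p)) :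
    Tendsto (fun n : ℕ => Real.log (fareyPeriodicSum β n) / n) atTop (𝓝 p) := by
  refine tendsto_log_of_fareyWeightSum_le (fun n hn => fareyPeriodicSum_pos β hn)
    (fun n hn => ?_) (fun n hn => ?_) hp
  · obtain ⟨x, hx, h⟩ := exists_fareyPeriodicSum_eq β hn
    rw [h]
    exact Finset.sum_le_sum fun e _ => rpow_le_fareyWeight β _
      (fareyDenominator_mono _ le_rfl (hx e).1 (hx e).2)
      (fareyDenominator_mono _ (hx e).1 (hx e).2 le_rfl)
  · obtain ⟨x, hx, h⟩ := exists_fareyPeriodicSum_eq β hn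
    rw [h, Finset.mul_sum]
    refine Finset.sum_le_sum fun e _ => ?_
    simpa using fareyWeight_le β (List.ofFn e)
      (fareyDenominator_mono _ le_rfl (hx e).1 (hx e).2)
      (fareyDenominator_mono _ (hx e).1 (hx e).2 le_rfl)

/-! ### Coefficients and radius of convergence of the zeta function -/

theorem coeff_zero_fareyZeta (β : ℝ) : PowerSeries.coeff 0 (fareyZeta β) = 1 := by
  have h : (fareyZeta β - 1).constantCoeff = 0 := by
    have h1 : fareyZeta β - 1 = (PowerSeries.exp ℝ - 1).subst (fareyLogZeta β) := by
      rw [PowerSeries.subst_sub (fareyLogZeta_hasSubst β), fareyZeta]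
      congr 1
      rw [← PowerSeries.coe_substAlgHom (fareyLogZeta_hasSubst β), map_one]
    rw [h1]
    have h0 : (fareyLogZeta β).constantCoeff = 0 := by simp [fareyLogZeta]
    exact PowerSeries.constantCoeff_subst_eq_zero h0 _ (by simp)
  rw [PowerSeries.coeff_zero_eq_constantCoeff_apply]
  rwa [map_sub, map_one, sub_eq_zero] at h

/-- The recursion for the coefficients of the zeta function equivalent to
`z ζ'(z) = ζ(z) ∑ n ≥ 1, Z_n z ^ n`. -/
theorem coeff_succ_fareyZeta (β : ℝ) (n : ℕ) :
    (n + 1) * PowerSeries.coeff (n + 1) (fareyZeta β) =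
      ∑ ij ∈ Finset.HasAntidiagonal.antidiagonal n,
        PowerSeries.coeff ij.1 (fareyZeta β) * fareyPeriodicSum β (ij.2 + 1) := by
  have h := PowerSeries.derivative_subst (f := PowerSeries.exp ℝ) (fareyLogZeta_hasSubst β)
  rw [PowerSeries.derivative_exp] at h
  have h' := congrArg (PowerSeries.coeff n) h
  change PowerSeries.coeff n (PowerSeries.derivative ℝ (fareyZeta β)) =
    PowerSeries.coeff n (fareyZeta β * _) at h'
  rw [PowerSeries.coeff_derivative, PowerSeries.coeff_mul] at h'
  rw [mul_comm, h']
  refine Finset.sum_congr rfl fun ij _ => ?_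
  rw [PowerSeries.coeff_derivative, fareyLogZeta, PowerSeries.coeff_mk, if_neg (Nat.succ_ne_zero _)]
  have : (ij.2 : ℝ) + 1 ≠ 0 := by positivity
  push_cast
  rw [div_mul_cancel₀ _ this]

theorem coeff_fareyZeta_nonneg (β : ℝ) (n : ℕ) : 0 ≤ PowerSeries.coeff n (fareyZeta β) := by
  induction n using Nat.strong_induction_on with
  | _ n ih =>
    cases n with
    | zero => rw [coeff_zero_fareyZeta]; exact zero_le_one
    | succ n =>
      refine (mul_nonneg_iff_of_pos_left (by positivity : (0 : ℝ) < n + 1)).1 ?_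
      rw [coeff_succ_fareyZeta]
      refine Finset.sum_nonneg fun ij hij => mul_nonneg (ih _ ?_)
        (fareyPeriodicSum_pos β (Nat.succ_ne_zero _)).le
      have := Finset.HasAntidiagonal.mem_antidiagonal.1 hij
      omega

/-- In the recursion all terms are nonnegative; only the one with the constant coefficient 1 is
kept. -/
theorem fareyPeriodicSum_le_coeff (β : ℝ) {n : ℕ} (hn : n ≠ 0) :
    fareyPeriodicSum β n ≤ n * PowerSeries.coeff n (fareyZeta β) := by
  obtain ⟨n, rfl⟩ := Nat.exists_eq_succ_of_ne_zero hn
  push_cast [Nat.succ_eq_add_one]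
  rw [coeff_succ_fareyZeta]
  refine le_trans (le_of_eq ?_) (Finset.single_le_sum (a := (0, n)) (fun ij _ => mul_nonneg
    (coeff_fareyZeta_nonneg β _) (fareyPeriodicSum_pos β (Nat.succ_ne_zero _)).le) (by simp))
  simp only [coeff_zero_fareyZeta, one_mul]

/-- With `u n = c_n r ^ n`, the recursion writes `(m + 1) u (m + 1)` as a convolution of `u` with
the summable `v`. If `C` bounds the earlier `u i`, this is at most `C ∑ v`, and once `m + 1 ≥ ∑ v`
the bound `C` propagates. The finitely many initial terms determine `C`. -/
theorem exists_coeff_fareyZeta_mul_pow_le (β : ℝ) {r : ℝ} (hr : 0 ≤ r)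
    (hs : Summable fun n => fareyPeriodicSum β (n + 1) * r ^ (n + 1)) :
    ∃ C, ∀ n, PowerSeries.coeff n (fareyZeta β) * r ^ n ≤ C := by
  set u : ℕ → ℝ := fun n => PowerSeries.coeff n (fareyZeta β) * r ^ n with hu
  set v : ℕ → ℝ := fun n => fareyPeriodicSum β (n + 1) * r ^ (n + 1) with hv
  have hu0 (n) : 0 ≤ u n := mul_nonneg (coeff_fareyZeta_nonneg β n) (pow_nonneg hr n)
  have hv0 (n) : 0 ≤ v n :=
    mul_nonneg (fareyPeriodicSum_pos β (Nat.succ_ne_zero _)).le (pow_nonneg hr _)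
  have hrec (n : ℕ) : (n + 1) * u (n + 1) = ∑ ij ∈ Finset.HasAntidiagonal.antidiagonal n, u ij.1 * v ij.2 := by
    simp only [hu, hv]
    rw [← mul_assoc, coeff_succ_fareyZeta, Finset.sum_mul]
    refine Finset.sum_congr rfl fun ij hij => ?_
    rw [← Finset.HasAntidiagonal.mem_antidiagonal.1 hij, add_assoc, pow_add]
    ring
  obtain ⟨N, hN⟩ := exists_nat_ge (∑' n, v n)
  refine ⟨∑ i ∈ Finset.range (N + 1), u i, fun n => ?_⟩
  set C := ∑ i ∈ Finset.range (N + 1), u i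
  have hC : 0 ≤ C := Finset.sum_nonneg fun i _ => hu0 i
  change u n ≤ C
  induction n using Nat.strong_induction_on with
  | _ n ih =>
    rcases le_or_gt n N with hn | hn
    · exact Finset.single_le_sum (fun i _ => hu0 i) (Finset.mem_range.2 (by omega))
    · obtain ⟨m, rfl⟩ : ∃ m, n = m + 1 := ⟨n - 1, by omega⟩
      have hm : (N : ℝ) ≤ m + 1 := by exact_mod_cast hn.le
      refine le_of_mul_le_mul_left (a := (m + 1 : ℝ)) ?_ (by positivity)
      calc (m + 1) * u (m + 1) = ∑ ij ∈ Finset.HasAntidiagonal.antidiagonal m, u ij.1 * v ij.2 := hrec m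
        _ ≤ ∑ ij ∈ Finset.HasAntidiagonal.antidiagonal m, C * v ij.2 := by
            refine Finset.sum_le_sum fun ij hij => mul_le_mul_of_nonneg_right (ih _ ?_) (hv0 _)
            have := Finset.HasAntidiagonal.mem_antidiagonal.1 hij
            omega
        _ = C * ∑ j ∈ Finset.range (m + 1), v j := by
            rw [← Finset.mul_sum, Finset.Nat.sum_antidiagonal_eq_sum_range_succ_mk,
              ← Finset.sum_range_reflect v]
            simp only [Nat.add_sub_cancel]
        _ ≤ C * ∑' j, v j := by
            gcongr
            exact hs.sum_le_tsum _ fun i _ => hv0 i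
        _ ≤ (m + 1) * C := by rw [mul_comm]; gcongr; linarith

theorem summable_fareyPeriodicSum_mul_exp {β p s : ℝ}
    (hp : Tendsto (fun n : ℕ => Real.log (fareyPeriodicSum β n) / n) atTop (𝓝 p))
    (hs : s < -p) :
    Summable fun n => fareyPeriodicSum β (n + 1) * Real.exp s ^ (n + 1) := by
  -- For `p < q < -s`, eventually `Z_n < exp (q n)`, so the series is dominated by a geometric one
  -- of ratio `exp (q + s) < 1`.
  obtain ⟨q, hpq, hqs⟩ := exists_between (lt_neg_of_lt_neg hs)
  refine (summable_nat_add_iff (f := fun n => fareyPeriodicSum β n * Real.exp s ^ n) 1).2 ?_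
  refine Summable.of_norm_bounded_eventually_nat (g := fun n => Real.exp (q + s) ^ n)
    (summable_geometric_of_lt_one (Real.exp_pos _).le (by rw [Real.exp_lt_one_iff]; linarith)) ?_
  filter_upwards [hp.eventually_lt_const hpq, eventually_gt_atTop 0] with n hn hn0
  have hZ := fareyPeriodicSum_pos β hn0.ne'
  have hn' : (0 : ℝ) < n := by exact_mod_cast hn0
  rw [div_lt_iff₀ hn', Real.log_lt_iff_lt_exp hZ] at hn
  rw [Real.norm_of_nonneg (by positivity), Real.exp_add, mul_pow, ← Real.exp_nat_mul q, mul_comm _ q]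
  gcongr

theorem fareyZetaRadius_eq {β p : ℝ}
    (hp : Tendsto (fun n : ℕ => Real.log (fareyPeriodicSum β n) / n) atTop (𝓝 p)) :
    fareyZetaRadius β = ENNReal.ofReal (Real.exp (-p)) := by
  have hnorm (n : ℕ) : ‖FormalMultilinearSeries.ofScalars ℂ
      (fun n => PowerSeries.coeff n (fareyZeta β)) n‖ = PowerSeries.coeff n (fareyZeta β) := by
    rw [FormalMultilinearSeries.ofScalars_norm, Real.norm_of_nonneg (coeff_fareyZeta_nonneg β n)]
  refine le_antisymm ?_ ?_
  · refine ENNReal.le_of_forall_nnreal_lt fun r hr => ?_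
    rcases eq_or_ne r 0 with rfl | hr0
    · simp
    have hrpos : (0 : ℝ) < r := by positivity
    obtain ⟨C, hC, h⟩ := FormalMultilinearSeries.norm_mul_pow_le_of_lt_radius _ hr
    -- This is `log (n C) / n`; the factor `n` is the loss in `Z_n ≤ n c_n`.
    have hlim : Tendsto (fun n : ℕ => Real.log n / n + Real.log C / n) atTop (𝓝 0) := by
      have h1 : Tendsto (fun x : ℝ => Real.log x ^ 1 / (1 * x + 0)) atTop (𝓝 0) :=
        Real.tendsto_pow_log_div_mul_add_atTop 1 0 1 one_ne_zero
      have h2 := (h1.comp tendsto_natCast_atTop_atTop).add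
        (tendsto_const_div_atTop_nhds_zero_nat (Real.log C))
      simpa using h2
    have hle : p + Real.log r ≤ 0 := by
      refine le_of_tendsto_of_tendsto (hp.add_const _) hlim ?_
      filter_upwards [eventually_gt_atTop 0] with n hn
      have hn' : (0 : ℝ) < n := by exact_mod_cast hn
      have hZ := fareyPeriodicSum_pos β hn.ne'
      have hb := h n
      rw [hnorm] at hb
      have hb' : fareyPeriodicSum β n * (r : ℝ) ^ n ≤ n * C := by
        refine (mul_le_mul_of_nonneg_right (fareyPeriodicSum_le_coeff β hn.ne')
          (by positivity)).trans ?_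
        rw [mul_assoc]
        gcongr
      have hlog := Real.log_le_log (by positivity) hb'
      rw [Real.log_mul hZ.ne' (by positivity), Real.log_mul hn'.ne' hC.ne', Real.log_pow] at hlog
      rw [← add_div, ← sub_nonneg]
      have : (Real.log n + Real.log C) / n - (Real.log (fareyPeriodicSum β n) / n + Real.log r) =
          (Real.log n + Real.log C - (Real.log (fareyPeriodicSum β n) + n * Real.log r)) / n := by
        field_simp
      rw [this]
      exact div_nonneg (by linarith) hn'.le
    rw [← ENNReal.ofReal_coe_nnreal]
    refine ENNReal.ofReal_le_ofReal ?_
    rw [← Real.log_le_iff_le_exp hrpos]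
    linarith
  · refine ENNReal.le_of_forall_nnreal_lt fun r hr => ?_
    rcases eq_or_ne r 0 with rfl | hr0
    · simp
    have hrpos : (0 : ℝ) < r := by positivity
    rw [← ENNReal.ofReal_coe_nnreal, ENNReal.ofReal_lt_ofReal_iff (Real.exp_pos _),
      ← Real.log_lt_iff_lt_exp hrpos] at hr
    have hs := summable_fareyPeriodicSum_mul_exp hp hr
    rw [Real.exp_log hrpos] at hs
    obtain ⟨C, hC⟩ := exists_coeff_fareyZeta_mul_pow_le β hrpos.le hs
    exact FormalMultilinearSeries.le_radius_of_bound _ C fun n => by rw [hnorm]; exact hC n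

/-! ### Values of the pressure and the phase transition -/

theorem fareyZetaRadius_eq_and_tendsto (β : ℝ) :
    fareyZetaRadius β = ENNReal.ofReal (Real.exp (-fareyPressure β)) ∧
      Tendsto (fun n : ℕ => Real.log (fareyPartitionFunction β n) / n) atTop
        (𝓝 (fareyPressure β)) := by
  obtain ⟨p, hp⟩ := exists_tendsto_log_fareyWeightSum β
  have hr := fareyZetaRadius_eq (tendsto_log_fareyPeriodicSum hp)
  have hP : fareyPressure β = p := by
    rw [fareyPressure, hr, ENNReal.toReal_ofReal (Real.exp_pos _).le, Real.log_exp, neg_neg]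
  rw [hP]
  exact ⟨hr, tendsto_log_fareyPartitionFunction hp⟩

theorem tendsto_fareyPressure (β : ℝ) :
    Tendsto (fun n : ℕ => Real.log (fareyPartitionFunction β n) / n) atTop
      (𝓝 (fareyPressure β)) :=
  (fareyZetaRadius_eq_and_tendsto β).2

theorem fareyPressure_zero : fareyPressure 0 = Real.log 2 := by
  refine tendsto_nhds_unique (tendsto_fareyPressure 0) (tendsto_const_nhds.congr' ?_)
  filter_upwards [eventually_gt_atTop 0] with n hn
  have hn' : (n : ℝ) ≠ 0 := by exact_mod_cast hn.ne'
  rw [fareyPartitionFunction_zero, Real.log_pow]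
  field_simp

theorem fareyPressure_of_one_le {β : ℝ} (hβ : 1 ≤ β) : fareyPressure β = 0 := by
  have hlow := tendsto_log_add_one_div.const_mul (-β)
  rw [mul_zero] at hlow
  refine tendsto_nhds_unique (tendsto_fareyPressure β)
    (tendsto_of_tendsto_of_tendsto_of_le_of_le hlow tendsto_const_nhds (fun n => ?_) fun n => ?_)
  · have h := Real.log_le_log (by positivity) (rpow_le_fareyPartitionFunction β n)
    rw [Real.log_rpow (by positivity)] at h
    rw [← mul_div_assoc]
    exact div_le_div_of_nonneg_right h n.cast_nonneg
  · exact div_nonpos_of_nonpos_of_nonneg (Real.log_nonpos (fareyPartitionFunction_pos β n).le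
      (fareyPartitionFunction_le_one hβ n)) n.cast_nonneg

theorem le_fareyPressure {β : ℝ} (hβ : 0 ≤ β) :
    Real.log 2 - β * Real.log 4 ≤ fareyPressure β := by
  refine ge_of_tendsto (tendsto_fareyPressure β) ?_
  filter_upwards [eventually_gt_atTop 0] with n hn
  have hn' : (0 : ℝ) < n := by exact_mod_cast hn
  have h := Real.log_le_log (by positivity) (two_pow_mul_rpow_le_fareyPartitionFunction hβ n)
  rw [Real.log_mul (by positivity) (by positivity), Real.log_rpow (by positivity), Real.log_pow,
    Real.log_pow] at h
  rw [le_div_iff₀ hn']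
  linarith

/-- Otherwise `P` would be analytic on the connected set `(0, ∞)` and zero near 2, hence zero at
`1/4`. But `le_fareyPressure` gives `P(1/4) ≥ (log 2) / 2`. -/
theorem exists_not_analyticAt_fareyPressure :
    ∃ β ∈ Ioc (0 : ℝ) 1, ¬ AnalyticAt ℝ fareyPressure β := by
  by_contra! h
  have hzero : ∀ β > 1, fareyPressure =ᶠ[𝓝 β] 0 := fun β hβ => by
    filter_upwards [Ioi_mem_nhds hβ] with γ hγ using fareyPressure_of_one_le (le_of_lt hγ)
  have han : AnalyticOnNhd ℝ fareyPressure (Ioi 0) := fun β hβ => by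
    rcases le_or_gt β 1 with h1 | h1
    · exact h β ⟨hβ, h1⟩
    · exact analyticAt_const.congr (hzero β h1).symm
  have heq := han.eqOn_zero_of_preconnected_of_eventuallyEq_zero isPreconnected_Ioi
    (z₀ := 2) (by simp) (hzero 2 (by norm_num))
  have h4 : fareyPressure (1 / 4) = 0 := heq (show (0 : ℝ) < 1 / 4 by norm_num)
  have hle := le_fareyPressure (β := 1 / 4) (by norm_num)
  have hlog : Real.log 4 = 2 * Real.log 2 := by
    rw [show (4 : ℝ) = 2 ^ 2 by norm_num, Real.log_pow]
    norm_num
  have := Real.log_pos one_lt_two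
  linarith

end

theorem mainTheorem8 :
    (∀ β : ℝ, 0 < fareyZetaRadius β ∧ fareyZetaRadius β < ⊤) ∧
    (∀ β : ℝ, Tendsto (fun n : ℕ => Real.log (fareyPartitionFunction β n) / n) atTop
      (𝓝 (fareyPressure β))) ∧
    fareyPressure 0 = Real.log 2 ∧
    (∀ β : ℝ, 1 ≤ β → fareyPressure β = 0) ∧
    ¬ AnalyticOnNhd ℝ fareyPressure univ ∧
    ∃ β ∈ Ioc (0 : ℝ) 1, ¬ AnalyticAt ℝ fareyPressure β := by
  refine ⟨fun β => ?_, tendsto_fareyPressure, fareyPressure_zero,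
    fun β => fareyPressure_of_one_le, fun h => ?_, exists_not_analyticAt_fareyPressure⟩
  · rw [(fareyZetaRadius_eq_and_tendsto β).1]
    exact ⟨ENNReal.ofReal_pos.2 (Real.exp_pos _), ENNReal.ofReal_lt_top⟩
  · obtain ⟨β, -, hβ⟩ := exists_not_analyticAt_fareyPressure
    exact hβ (h β (mem_univ β))
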